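/- Let $\langle X\mid R\rangle$ be a finite presentation of a group $G$, where $R$ is a finite set of elements of the free group $F(X)$. Write $\|\cdot\|$ for the length in $F(X)$. The Miller machine $M(G)$ is the group generated by $X$, letters $\theta_\alpha$ ($\alpha\in X\sqcup R$) and a letter $q$, with defining relations $\theta_\alpha x=x\theta_\alpha$ ($x\in X$, $\alpha\in X\sqcup R$), $\theta_x x q=q x\theta_x$ ($x\in X$), $\theta_r q=q r\theta_r$ ($r\in R$). Let $|\cdot|$ be its word length with respect to these generators, and for conjugate $x,y\in M(G)$ let $c(x,y)=\min\{|\gamma| : \gamma x\gamma^{-1}=y\}$. Let $k\ge 1$ and $\sigma=(\sigma_1,\dots,\sigma_k)\in\{\pm1\}^k$, with indices read cyclically ($\sigma_{k+1}=\sigma_1$). Consider only $k$-tuples $\mathbf u=(u_1,\dots,u_k)$ in $F(X)$ such that, for all $1\le i\le k$, $\sigma_i=-\sigma_{i+1}$ implies $u_i\neq 1$ (that is, the cyclic word $q^{\sigma_1}u_1\cdots q^{\sigma_k}u_k$ is reduced). Write $\mathbf u\overset{\sigma}{\sim}\mathbf v$ if there are $w,\varepsilon\in F(X)$ with $\varepsilon=_G1$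 such that, in $F(X)$ and for all $1\le i\le k$, $v_i=w\varepsilon u_iw^{-1}$ if $(\sigma_i,\sigma_{i+1})=(1,1)$; $v_i=w\varepsilon u_i\varepsilon^{-1}w^{-1}$ if it is $(1,-1)$; $v_i=wu_iw^{-1}$ if it is $(-1,1)$; $v_i=wu_i\varepsilon^{-1}w^{-1}$ if it is $(-1,-1)$. Let $c_{k,\sigma}(\mathbf u,\mathbf v)$ be the least $\|w\|$ over all such $w,\varepsilon$, and $$\mathbf C_{k,\sigma}(n)=\max\{c_{k,\sigma}(\mathbf u,\mathbf v) : \mathbf u\overset{\sigma}{\sim}\mathbf v,\ \textstyle\sum_i(\|u_i\|+\|v_i\|)\le n\}.$$ Let $D_{k,\sigma}(n)$ be the maximum of $c(x,y)$ over all pairs $x=q^{\sigma_1}u_1\cdots q^{\sigma_k}u_k$, $y=q^{\sigma_1}v_1\cdots q^{\sigma_k}v_k$ (with $\mathbf u,\mathbf v$ as above) that are conjugate in $M(G)$ and satisfy $\sum_i(\|u_i\|+\|v_i\|)\le n-2k$; it is $0$ if there are no such pairs. For $g\in F(X)$ with $g=_G1$ let $\lambda(g)$ be the minimum of $m+\|w_1\|+\|w_m\|+\sum_{j=1}^{m-1}\|w_j^{-1}w_{j+1}\|$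 over all expressions $g=\prod_{j=1}^m w_jr_jw_j^{-1}$ with $w_j\in F(X)$, $r_j\in R^{\pm1}$ (with $\lambda(1)=0$), and let $\Lambda(n)=\max\{\lambda(g): g=_G1,\ \|g\|\le n\}$. Let $t=\max(\{\|r\|:r\in R\}\cup\{2\})$. **Theorem C.** (1) For all $k\ge1$ and $\sigma\in\{\pm1\}^k$, $\;D_{k,\sigma}(n)\ge \mathbf C_{k,\sigma}(n-2k)/t\;$ for all $n$ large enough. (2) Suppose that $R$ contains a nontrivial element of $F(X)$. Then there are constants $M$ and $N$, depending only on the presentation, such that for all $k\ge1$, all $\sigma\in\{\pm1\}^k$ with $\sigma_i=\sigma_{i+1}$ for some (cyclic) index $i$, and all $n\ge N$, $$D_{k,\sigma}(n)\le(2M+1)\,\Lambda\bigl(2\,\mathbf C_{k,\sigma}(n)+n\bigr).$$ -/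

import Mathlib

namespace Miller

/-- The generators of the Miller machine of `⟨X | R⟩`: the letters of `X`, one letter `θ_α` for
every `α` in the disjoint union of `X` and `R`, and the letter `q`. -/
inductive Gen {X : Type*} (R : Finset (FreeGroup X)) where
  | base (x : X) : Gen R
  | theta (α : X ⊕ {r // r ∈ R}) : Gen R
  | q : Gen R

section presentation

variable {X : Type*} (R : Finset (FreeGroup X))

/-- The letter `θ_α` in the free group on the generators. -/
def thetaF (α : X ⊕ {r // r ∈ R}) : FreeGroup (Gen R) := FreeGroup.of (Gen.theta α)

/-- The letter `q` in the free group on the generators. -/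
def qF : FreeGroup (Gen R) := FreeGroup.of Gen.q

/-- A word on `X`, read as a word on the generators of the Miller machine. -/
def baseF : FreeGroup X →* FreeGroup (Gen R) := FreeGroup.map Gen.base

/-- The defining relators of the Miller machine, from the relations
`θ_α x = x θ_α`, `θ_x x q = q x θ_x` and `θ_r q = q r θ_r`. -/
def relators : Set (FreeGroup (Gen R)) :=
  {g | (∃ (α : X ⊕ {r // r ∈ R}) (x : X),
          g = (thetaF R α * baseF R (FreeGroup.of x)) *
              (baseF R (FreeGroup.of x) * thetaF R α)⁻¹) ∨
       (∃ x : X,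
          g = (thetaF R (Sum.inl x) * baseF R (FreeGroup.of x) * qF R) *
              (qF R * baseF R (FreeGroup.of x) * thetaF R (Sum.inl x))⁻¹) ∨
       (∃ r : {r // r ∈ R},
          g = (thetaF R (Sum.inr r) * qF R) *
              (qF R * baseF R (r : FreeGroup X) * thetaF R (Sum.inr r))⁻¹)}

/-- The group `G = ⟨X | R⟩`. -/
abbrev Grp : Type _ := PresentedGroup (R : Set (FreeGroup X))

/-- The Miller machine `M(G)` of the presentation `⟨X | R⟩`. -/
abbrev Machine : Type _ := PresentedGroup (relators R)

/-- The element of `M(G)` given by a word on `X`. -/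
def baseM : FreeGroup X →* Machine R := (PresentedGroup.mk (relators R)).comp (baseF R)

/-- The element `q` of `M(G)`. -/
def qM : Machine R := PresentedGroup.mk (relators R) (qF R)

/-- The word length in `M(G)` with respect to its generators. -/
noncomputable def machineLength (g : Machine R) : ℕ :=
  sInf {n | ∃ L : List (Gen R × Bool),
    L.length = n ∧ PresentedGroup.mk (relators R) (FreeGroup.mk L) = g}

/-- The least length of an element of `M(G)` that conjugates `x` to `y`. -/
noncomputable def conjLength (x y : Machine R) : ℕ :=
  sInf {n | ∃ γ : Machine R, γ * x * γ⁻¹ = y ∧ n = machineLength R γ}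

/-- The element `q^{σ₁} u₁ q^{σ₂} u₂ ⋯ q^{σₖ} uₖ` of `M(G)`. -/
def qElem {k : ℕ} (σ : Fin k → ℤˣ) (u : Fin k → FreeGroup X) : Machine R :=
  (List.ofFn fun i => qM R ^ ((σ i : ℤˣ) : ℤ) * baseM R (u i)).prod

end presentation

section tuples

variable {X : Type*}

/-- The cyclic word `q^{σ₁} u₁ ⋯ q^{σₖ} uₖ` is reduced: `uᵢ` is nontrivial whenever
`σᵢ = -σᵢ₊₁`. Indices are cyclic, as addition in `Fin k` is modulo `k`. -/
def Reduced {k : ℕ} [NeZero k] (σ : Fin k → ℤˣ) (u : Fin k → FreeGroup X) : Prop :=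
  ∀ i, σ i = -σ (i + 1) → u i ≠ 1

/-- `w` and `ε` witness that `u` and `v` are iso-computationally list-conjugate via `σ`. -/
def Witness (R : Finset (FreeGroup X)) {k : ℕ} [NeZero k] (σ : Fin k → ℤˣ)
    (u v : Fin k → FreeGroup X) (w ε : FreeGroup X) : Prop :=
  PresentedGroup.mk (R : Set (FreeGroup X)) ε = 1 ∧
  ∀ i,
    (σ i = 1 → σ (i + 1) = 1 → w * ε * u i * w⁻¹ = v i) ∧
    (σ i = 1 → σ (i + 1) = -1 → w * ε * u i * ε⁻¹ * w⁻¹ = v i) ∧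
    (σ i = -1 → σ (i + 1) = 1 → w * u i * w⁻¹ = v i) ∧
    (σ i = -1 → σ (i + 1) = -1 → w * u i * ε⁻¹ * w⁻¹ = v i)

/-- Iso-computational list conjugacy of `u` and `v` via `σ`. -/
def ListConj (R : Finset (FreeGroup X)) {k : ℕ} [NeZero k] (σ : Fin k → ℤˣ)
    (u v : Fin k → FreeGroup X) : Prop :=
  Reduced σ u ∧ Reduced σ v ∧ ∃ w ε, Witness R σ u v w ε

end tuples

section functions

variable {X : Type*} [DecidableEq X]

/-- The total length `∑ (‖uᵢ‖ + ‖vᵢ‖)` of two tuples. -/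
def totalLength {k : ℕ} (u v : Fin k → FreeGroup X) : ℕ :=
  ∑ i, ((u i).norm + (v i).norm)

/-- The least `‖w‖` over all witnesses `w`, `ε`. -/
noncomputable def listConjLength (R : Finset (FreeGroup X)) {k : ℕ} [NeZero k]
    (σ : Fin k → ℤˣ) (u v : Fin k → FreeGroup X) : ℕ :=
  sInf {m | ∃ w ε, Witness R σ u v w ε ∧ m = w.norm}

/-- `C_{k,σ}(n)`. For finite `X` it is the maximum of a finite nonempty set. -/
noncomputable def CFun (R : Finset (FreeGroup X)) {k : ℕ} [NeZero k]
    (σ : Fin k → ℤˣ) (n : ℕ) : ℕ :=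
  sSup {m | ∃ u v : Fin k → FreeGroup X, ListConj R σ u v ∧ totalLength u v ≤ n ∧
    m = listConjLength R σ u v}

/-- `D_{k,σ}(n)`. For finite `X` it is the maximum of a finite set (empty if `n < 2k`). -/
noncomputable def DFun (R : Finset (FreeGroup X)) {k : ℕ} [NeZero k]
    (σ : Fin k → ℤˣ) (n : ℕ) : ℕ :=
  sSup {m | ∃ u v : Fin k → FreeGroup X, Reduced σ u ∧ Reduced σ v ∧
    IsConj (qElem R σ u) (qElem R σ v) ∧ totalLength u v + 2 * k ≤ n ∧
    m = conjLength R (qElem R σ u) (qElem R σ v)}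

/-- The length `∑ ‖gᵢ⁻¹ gᵢ₊₁‖` of a path `g₁, g₂, …` in the free group. -/
def pathLength : List (FreeGroup X) → ℕ
  | [] => 0
  | [_] => 0
  | a :: b :: l => (a⁻¹ * b).norm + pathLength (b :: l)

/-- For a product of conjugates of relators, given as the list of the pairs `(wⱼ, rⱼ)`, the number
`m + ‖w₁‖ + ‖wₘ‖ + ∑ ‖wⱼ⁻¹ wⱼ₊₁‖`; the two extra terms come from the steps `1, w₁` and `wₘ, 1`. -/
def productCost (l : List (FreeGroup X × FreeGroup X)) : ℕ :=
  l.length + pathLength (1 :: (l.map Prod.fst ++ [1]))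

/-- `λ(g)`: the least cost of an expression of `g` as a product of conjugates `w r w⁻¹`
with `r ∈ R ∪ R⁻¹`. -/
noncomputable def lambdaLength (R : Finset (FreeGroup X)) (g : FreeGroup X) : ℕ :=
  sInf {m | ∃ l : List (FreeGroup X × FreeGroup X),
    (∀ p ∈ l, p.2 ∈ R ∨ p.2⁻¹ ∈ R) ∧
    (l.map fun p => p.1 * p.2 * p.1⁻¹).prod = g ∧ m = productCost l}

/-- `Λ(n)`. For finite `X` it is the maximum of a finite nonempty set. -/
noncomputable def LambdaFun (R : Finset (FreeGroup X)) (n : ℕ) : ℕ :=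
  sSup {m | ∃ g : FreeGroup X, PresentedGroup.mk (R : Set (FreeGroup X)) g = 1 ∧ g.norm ≤ n ∧
    m = lambdaLength R g}

/-- `t`, the maximum of `2` and the lengths of the relators. -/
def tConst (R : Finset (FreeGroup X)) : ℕ := max 2 (R.sup FreeGroup.norm)

end functions

end Miller

/-! A letter `θ` of `M(G)` commutes with `F(X)` and conjugates `q` to `a⁻¹ q b`, with `(a, b) = (x,
x)` for `θ_x` and `(1, r)` for `θ_r`. Hence `M(G)` maps to the semidirect product of the free group
on `X ⊔ {q}` with `F(X) × F(X)` (`rep`); faithfulness is not needed. The pairs `(a, b)` that occur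
satisfy `a =_G b`, so `b = aε` with `ε =_G 1`. Substituting `a⁻¹ q b` for `q` in a cyclic `q`-word
changes its tuple exactly as the witness `(a, ε)` does (`witness_iff`, `map_qWord_eq_twist`).
Conjugate cyclically reduced words are rotations of each other, so conjugacy in `M(G)` forces list
conjugacy up to a rotation that preserves `σ` (`exists_rotation_twist`).

Lower bound: if the tuples are already list conjugate, uniqueness of roots in free groups removes
the rotation (`twist_eq_self`). A conjugator `γ` then yields a witness `w = a` with `‖a‖ ≤ |γ|`,
since each generator contributes at most one letter to `a`.

Upper bound: a shortest witness `w` has length at most `C`, and two equal consecutive signs bound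
`ε` in terms of `w` (`Witness.norm_le`). The pair `(w, wε)` lifts to `M(G)` at cost `‖w‖ + λ(ε)`
(`Witness.exists_acts`); a base element and a prefix of the `q`-word complete the conjugator. The
linear terms are absorbed because `Λ` grows at least linearly (`le_mul_LambdaFun`). -/

namespace FreeGroup

/-! ### Conjugacy of cyclically reduced words -/

variable {α : Type*}

theorem IsCyclicallyReduced.rotate_one {a : α × Bool} {l : List (α × Bool)}
    (h : IsCyclicallyReduced (a :: l)) : IsCyclicallyReduced (l ++ [a]) := by
  rcases l.eq_nil_or_concat with rfl | ⟨l', b, rfl⟩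
  · simp
  · rw [List.concat_eq_append, ← List.cons_append, isCyclicallyReduced_cons_append_iff] at h
    rw [List.concat_eq_append]
    refine ⟨(h.1.infix ⟨[a], [], by simp⟩).append_overlap (L₃ := [a]) ?_ (by simp), ?_⟩
    · simpa using h.2
    · cases l' with
      | nil => simpa [eq_comm] using h.2
      | cons x l' =>
        have := h.1
        simp only [List.cons_append, IsReduced, List.isChain_cons_cons] at this
        intro y hy z hz hyz
        rw [List.getLast?_concat] at hy
        obtain rfl : a = y := by simpa using hy
        obtain rfl : x = z := by simpa using hz
        exact this.1 hyz

theorem IsCyclicallyReduced.rotate {l : List (α × Bool)} (h : IsCyclicallyReduced l) (n : ℕ) :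
    IsCyclicallyReduced (l.rotate n) := by
  induction n generalizing l with
  | zero => simpa
  | succ n ih =>
    cases l with
    | nil => simp
    | cons a l =>
      rw [List.rotate_cons_succ]
      exact ih h.rotate_one

/-- Induction on the conjugator from its right end `c`: either `c` cancels against an end of `A`,
which amounts to rotating `A` by one letter and shortens the conjugator, or nothing cancels and the
conjugate is not cyclically reduced. -/
theorem IsCyclicallyReduced.isRotated_of_mk_mul_eq {B : List (α × Bool)}
    (hB : IsCyclicallyReduced B) (F : List (α × Bool)) (hF : IsReduced F)
    (A : List (α × Bool)) (hA : IsCyclicallyReduced A) (h : mk F * mk A = mk B * mk F) :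
    A.IsRotated B := by
  classical
  induction F using List.reverseRecOn generalizing A with
  | nil =>
    have h' : mk A = mk B := by simpa [← one_eq_mk] using h
    have := reduce.sound h'
    rw [hA.isReduced.reduce_eq, hB.isReduced.reduce_eq] at this
    rw [this]
  | append_singleton F c ih =>
    have hF' : IsReduced F := hF.infix ⟨[], [c], by simp⟩
    have hc : mk [(c.1, !c.2)] * mk [c] = 1 := by
      have : mk [(c.1, !c.2)] = (mk [c])⁻¹ := by simp [invRev]
      rw [this, inv_mul_cancel]
    have hc' : mk [c] * mk [(c.1, !c.2)] = 1 := mul_eq_one_comm.1 hc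
    rw [← mul_mk (L₁ := F)] at h
    by_cases h1 : A.head? = some (c.1, !c.2)
    · obtain ⟨A', rfl⟩ : ∃ A', A = (c.1, !c.2) :: A' := by
        cases A with
        | nil => simp at h1
        | cons x A' => exact ⟨A', by simpa using h1⟩
      have key := ih hF' (A' ++ [(c.1, !c.2)]) hA.rotate_one (by
        rw [show mk ((c.1, !c.2) :: A') = mk [(c.1, !c.2)] * mk A' by simp] at h
        rw [← mul_mk]
        have e1 : mk F * mk A' = mk B * (mk F * mk [c]) := by
          rw [← h]
          calc mk F * mk A' = mk F * (mk [c] * mk [(c.1, !c.2)]) * mk A' := by rw [hc']; group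
            _ = _ := by group
        rw [← mul_assoc, e1]
        calc mk B * (mk F * mk [c]) * mk [(c.1, !c.2)]
            = mk B * mk F * (mk [c] * mk [(c.1, !c.2)]) := by group
          _ = _ := by rw [hc']; group)
      exact List.IsRotated.trans ⟨1, by simp⟩ key
    · by_cases h2 : A.getLast? = some c
      · obtain ⟨A', rfl⟩ : ∃ A', A = A' ++ [c] := by
          rcases A.eq_nil_or_concat with rfl | ⟨A', x, rfl⟩
          · simp at h2
          · exact ⟨A', by simpa using h2⟩
        have hrot : (A' ++ [c]).rotate A'.length = c :: A' := by simp
        have key := ih hF' (c :: A') (hrot ▸ hA.rotate _) (by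
          rw [← mul_mk] at h
          rw [← List.singleton_append, ← mul_mk]
          have : mk F * mk [c] * mk A' * mk [c] = mk B * mk F * mk [c] := by
            rw [mul_assoc, h, mul_assoc]
          simpa [mul_assoc] using mul_right_cancel this)
        exact List.IsRotated.trans ⟨A'.length, hrot⟩ key
      · rcases eq_or_ne A [] with rfl | hA0
        · have hB1 : mk B = 1 := by
            rw [← one_eq_mk, mul_one] at h
            exact (right_eq_mul.1 h)
          have := reduce.sound (hB1.trans one_eq_mk)
          rw [hB.isReduced.reduce_eq, reduce_nil] at this
          rw [this]
        exfalso
        -- No cancellation at either end of the nonempty `A`, so this word is `B` itself; its first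
        -- and last letters are mutually inverse, against cyclic reducedness.
        have hred : IsReduced ((F ++ [c]) ++ A ++ invRev (F ++ [c])) := by
          apply IsReduced.append_overlap _ _ hA0
          · simp only [IsReduced, List.isChain_append] at hF ⊢
            refine ⟨hF, hA.1, ?_⟩
            intro x hx y hy hxy
            simp only [List.getLast?_append, List.getLast?_singleton] at hx
            have hx' : x = c := by simpa using hx.symm
            subst hx'
            by_contra hne
            apply h1
            rw [Option.mem_def] at hy
            rw [hy]
            congr 1
            ext <;> grind
          · have hinv : IsReduced (invRev (F ++ [c])) := by
              rw [isReduced_iff_reduce_eq, reduce_invRev, hF.reduce_eq]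
            simp only [IsReduced, List.isChain_append] at hinv ⊢
            refine ⟨hA.1, hinv, ?_⟩
            intro x hx y hy hxy
            have hy' : y = (c.1, !c.2) := by simpa [invRev] using hy.symm
            by_contra hne
            apply h2
            rw [Option.mem_def] at hx
            rw [hx]
            congr 1
            ext
            · grind
            · cases hx2 : x.2 <;> cases hc2 : c.2 <;> simp_all
        have hBeq : mk ((F ++ [c]) ++ A ++ invRev (F ++ [c])) = mk B := by
          rw [← mul_mk, ← mul_mk, ← inv_mk, ← mul_mk, h]
          group
        have := reduce.sound hBeq
        rw [hred.reduce_eq, hB.isReduced.reduce_eq] at this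
        rw [← this] at hB
        obtain ⟨d, D, hD⟩ : ∃ d D, F ++ [c] = d :: D := by
          cases F with
          | nil => exact ⟨c, [], rfl⟩
          | cons x F => exact ⟨x, F ++ [c], rfl⟩
        rw [hD] at hB
        have hlast : (d :: D ++ A ++ invRev (d :: D)).getLast? = some (d.1, !d.2) := by
          have : d :: D ++ A ++ invRev (d :: D) =
              (d :: D ++ A ++ invRev D) ++ [(d.1, !d.2)] := by simp [invRev]
          rw [this, List.getLast?_concat]
        have := hB.2 (d.1, !d.2) hlast d (by simp) rfl
        simp at this

theorem IsCyclicallyReduced.isRotated_of_isConj {A B : List (α × Bool)}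
    (hA : IsCyclicallyReduced A) (hB : IsCyclicallyReduced B) (h : IsConj (mk A) (mk B)) :
    A.IsRotated B := by
  classical
  obtain ⟨f, hf⟩ := isConj_iff.1 h
  refine hB.isRotated_of_mk_mul_eq f.toWord isReduced_toWord A hA ?_
  rw [mk_toWord, ← hf]
  group

/-- Supplies the bounds for the suprema defining `C`, `D` and `Λ`, since `sSup` of an unbounded set
of naturals is `0`. -/
theorem finite_norm_le [Finite α] [DecidableEq α] (n : ℕ) :
    {g : FreeGroup α | g.norm ≤ n}.Finite :=
  (List.finite_length_le (α × Bool) n).preimage toWord_injective.injOn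

end FreeGroup

/-! ### Cyclic `q`-words and their rotations -/

namespace Miller

variable {X : Type*}

/-- The word `q^{σ₁} u₁ ⋯ q^{σₖ} uₖ` in a group `H` with a letter `q` and a copy of `F(X)`. -/
def qWord {H : Type*} [Group H] (β : FreeGroup X →* H) (q : H) {k : ℕ} (σ : Fin k → ℤˣ)
    (u : Fin k → FreeGroup X) : H :=
  (List.ofFn fun i => q ^ ((σ i : ℤˣ) : ℤ) * β (u i)).prod

theorem qElem_eq_qWord (R : Finset (FreeGroup X)) {k : ℕ} (σ : Fin k → ℤˣ)
    (u : Fin k → FreeGroup X) : qElem R σ u = qWord (baseM R) (qM R) σ u := rfl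

theorem map_qWord {H K : Type*} [Group H] [Group K] (f : H →* K) (β : FreeGroup X →* H) (q : H)
    {k : ℕ} (σ : Fin k → ℤˣ) (u : Fin k → FreeGroup X) :
    f (qWord β q σ u) = qWord (f.comp β) (f q) σ u := by
  simp [qWord, map_list_prod, List.map_ofFn, Function.comp_def]

section block

variable [DecidableEq X]

/-- The word over `X` and one more letter that spells `q^s u`. -/
def block (p : ℤˣ × FreeGroup X) : List (Option X × Bool) :=
  (none, decide (p.1 = 1)) :: p.2.toWord.map fun a => (some a.1, a.2)

/-- The concatenation of the words that spell `q^s u`. -/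
def blocks (L : List (ℤˣ × FreeGroup X)) : List (Option X × Bool) := L.flatMap block

theorem blocks_append (L L' : List (ℤˣ × FreeGroup X)) :
    blocks (L ++ L') = blocks L ++ blocks L' := by simp [blocks]

theorem blocks_cons (p : ℤˣ × FreeGroup X) (L : List (ℤˣ × FreeGroup X)) :
    blocks (p :: L) = block p ++ blocks L := by simp [blocks]

theorem mk_block (p : ℤˣ × FreeGroup X) :
    FreeGroup.mk (block p) =
      FreeGroup.of none ^ ((p.1 : ℤˣ) : ℤ) * FreeGroup.map some p.2 := by
  have h : FreeGroup.map (some : X → Option X) p.2 =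
      FreeGroup.mk (p.2.toWord.map fun a => (some a.1, a.2)) := by
    conv_lhs => rw [← FreeGroup.mk_toWord (x := p.2), FreeGroup.map.mk]
  have h' : FreeGroup.of (none : Option X) ^ ((p.1 : ℤˣ) : ℤ) =
      FreeGroup.mk [(none, decide (p.1 = 1))] := by
    rcases Int.units_eq_one_or p.1 with h | h <;> rw [h] <;> simp [FreeGroup.of, FreeGroup.invRev]
  rw [h, h', FreeGroup.mul_mk]
  rfl

theorem mk_blocks_ofFn {k : ℕ} (σ : Fin k → ℤˣ) (u : Fin k → FreeGroup X) :
    FreeGroup.mk (blocks (List.ofFn fun i => (σ i, u i))) =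
      qWord (FreeGroup.map some) (FreeGroup.of none) σ u := by
  have h : ∀ L : List (ℤˣ × FreeGroup X),
      FreeGroup.mk (blocks L) = (L.map fun p => FreeGroup.mk (block p)).prod := by
    intro L
    induction L with
    | nil => rfl
    | cons p L ih => rw [blocks_cons, ← FreeGroup.mul_mk, ih, List.map_cons, List.prod_cons]
  rw [h, List.map_ofFn, qWord]
  simp [Function.comp_def, mk_block]

theorem block_append_inj {p p' : ℤˣ × FreeGroup X} {L L' : List (ℤˣ × FreeGroup X)}
    (h : block p ++ blocks L = block p' ++ blocks L') : p = p' ∧ blocks L = blocks L' := by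
  have key : ∀ (A A' : List (X × Bool)) (L L' : List (ℤˣ × FreeGroup X)),
      A.map (fun a => (some a.1, a.2)) ++ blocks L =
        A'.map (fun a => (some a.1, a.2)) ++ blocks L' → A = A' ∧ blocks L = blocks L' := by
    intro A
    induction A with
    | nil =>
      intro A' L L' h
      cases A' with
      | nil => exact ⟨rfl, by simpa using h⟩
      | cons a A' =>
        cases L with
        | nil => simp [blocks] at h
        | cons p L => simp [blocks_cons, block] at h
    | cons a A ih =>
      intro A' L L' h
      cases A' with
      | nil =>
        cases L' with
        | nil => simp [blocks] at h
        | cons p L => simp [blocks_cons, block] at h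
      | cons a' A' =>
        simp only [List.map_cons, List.cons_append, List.cons.injEq, Prod.mk.injEq,
          Option.some.injEq] at h
        obtain ⟨h1, h2⟩ := ih A' L L' h.2
        exact ⟨by rw [h1, Prod.ext h.1.1 h.1.2], h2⟩
  obtain ⟨s, g⟩ := p
  obtain ⟨s', g'⟩ := p'
  simp only [block, List.cons_append, List.cons.injEq, Prod.mk.injEq, true_and] at h
  obtain ⟨h1, h2⟩ := key _ _ _ _ h.2
  refine ⟨Prod.ext ?_ (FreeGroup.toWord_injective h1), h2⟩
  have h0 := h.1
  rcases Int.units_eq_one_or s with rfl | rfl <;>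
    rcases Int.units_eq_one_or s' with rfl | rfl <;> first | rfl | simp at h0

theorem blocks_injective : Function.Injective (blocks (X := X)) := by
  intro L
  induction L with
  | nil =>
    intro L' h
    cases L' with
    | nil => rfl
    | cons p L' => simp [blocks, block] at h
  | cons p L ih =>
    intro L' h
    cases L' with
    | nil => simp [blocks, block] at h
    | cons p' L' =>
      rw [blocks_cons, blocks_cons] at h
      obtain ⟨h1, h2⟩ := block_append_inj h
      rw [h1, ih h2]

/-- The letter `none` occurs only at the start of a block, so a cut just before it is a cut between
blocks. -/
theorem exists_append_of_blocks_eq {L : List (ℤˣ × FreeGroup X)} {P Q : List (Option X × Bool)}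
    {b : Bool} (h : blocks L = P ++ (none, b) :: Q) :
    ∃ L₁ L₂, L = L₁ ++ L₂ ∧ blocks L₁ = P ∧ blocks L₂ = (none, b) :: Q := by
  induction L generalizing P with
  | nil => simp [blocks] at h
  | cons p L ih =>
    cases P with
    | nil => exact ⟨[], p :: L, rfl, rfl, h⟩
    | cons x P =>
      have h' := h
      rw [blocks_cons, block, List.cons_append, List.cons_append, List.cons.injEq] at h
      obtain ⟨P', rfl, hP'⟩ : ∃ P', P = (p.2.toWord.map fun a => (some a.1, a.2)) ++ P' ∧
          blocks L = P' ++ (none, b) :: Q := by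
        rcases List.append_eq_append_iff.1 h.2 with ⟨P', h1, h2⟩ | ⟨P', h1, h2⟩
        · exact ⟨P', h1, h2⟩
        · cases P' with
          | nil => exact ⟨[], by simpa using h1.symm, by simpa using h2.symm⟩
          | cons y P' =>
            exfalso
            have hy : (none, b) ∈ p.2.toWord.map fun a => ((some a.1, a.2) : Option X × Bool) := by
              rw [h1]
              simp only [List.cons_append, List.cons.injEq] at h2
              simp [h2.1]
            simp at hy
      obtain ⟨L₁, L₂, rfl, h1, h2⟩ := ih hP'
      refine ⟨p :: L₁, L₂, rfl, ?_, h2⟩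
      rw [blocks_cons, h1, block, List.cons_append, h.1]

/-- The target starts with `none`, so a rotation of letters must cut between blocks and is a
rotation of blocks. -/
theorem isRotated_of_blocks {L L' : List (ℤˣ × FreeGroup X)}
    (h : (blocks L).IsRotated (blocks L')) : L.IsRotated L' := by
  cases L' with
  | nil =>
    have : blocks L = [] := by simpa [blocks] using h
    rw [blocks_injective (a₂ := []) this]
  | cons p L' =>
    obtain ⟨n, hn, hrot⟩ := List.isRotated_iff_mod.1 h
    rw [List.rotate_eq_drop_append_take hn] at hrot
    rcases hd : (blocks L).drop n with _ | ⟨y, Q⟩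
    · have : (blocks L).take n = blocks L := by
        conv_rhs => rw [← List.take_append_drop n (blocks L), hd, List.append_nil]
      rw [hd, this, List.nil_append] at hrot
      rw [blocks_injective hrot]
    · rw [hd] at hrot
      have hy : y = (none, decide (p.1 = 1)) := by
        rw [blocks_cons, block, List.cons_append, List.cons_append] at hrot
        exact (List.cons.inj hrot).1
      have hsplit : blocks L = (blocks L).take n ++ (none, decide (p.1 = 1)) :: Q := by
        conv_lhs => rw [← List.take_append_drop n (blocks L), hd, hy]
      obtain ⟨L₁, L₂, rfl, h1, h2⟩ := exists_append_of_blocks_eq hsplit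
      have : blocks (L₂ ++ L₁) = blocks (p :: L') := by
        rw [blocks_append, h1, h2, ← hrot, hy]
      rw [← blocks_injective this]
      exact List.isRotated_append

theorem isReduced_block (p : ℤˣ × FreeGroup X) : FreeGroup.IsReduced (block p) := by
  have h : List.IsChain (fun a b : X × Bool => a.1 = b.1 → a.2 = b.2) p.2.toWord :=
    FreeGroup.isReduced_toWord
  rw [block, FreeGroup.IsReduced, List.isChain_cons, List.isChain_map]
  refine ⟨?_, h.imp fun a b hab => by simpa using hab⟩
  cases p.2.toWord <;> simp

/-- Adjacent blocks of a reduced `q`-word do not cancel. -/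
theorem block_junction {p p' : ℤˣ × FreeGroup X} (h : p.1 = -p'.1 → p.2 ≠ 1)
    (x : Option X × Bool) (hx : x ∈ (block p).getLast?) (hxy : x.1 = none) :
    x.2 = decide (p'.1 = 1) := by
  rw [block] at hx
  rcases hl : p.2.toWord.eq_nil_or_concat with h0 | ⟨l, a, h0⟩
  · rw [h0] at hx
    have hx' : x = (none, decide (p.1 = 1)) := by simpa using hx.symm
    rw [FreeGroup.toWord_eq_nil_iff] at h0
    have hne : p.1 ≠ -p'.1 := fun hc => h hc h0
    subst hx'
    rcases Int.units_eq_one_or p.1 with h1 | h1 <;>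
      rcases Int.units_eq_one_or p'.1 with h2 | h2 <;> simp_all
  · rw [h0, List.concat_eq_append, List.map_append, ← List.cons_append, List.map_singleton,
      List.getLast?_concat] at hx
    have hx' : x = (some a.1, a.2) := by simpa using hx.symm
    simp [hx'] at hxy

theorem isCyclicallyReduced_blocks {k : ℕ} [NeZero k] {σ : Fin k → ℤˣ} {u : Fin k → FreeGroup X}
    (h : Reduced σ u) :
    FreeGroup.IsCyclicallyReduced (blocks (List.ofFn fun i => (σ i, u i))) := by
  -- Since `i + 1` is cyclic, this covers both the inner junctions and the one from the last block
  -- to the first.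
  have hjoin : ∀ i : Fin k, ∀ x ∈ (block (σ i, u i)).getLast?,
      ∀ y ∈ (block (σ (i + 1), u (i + 1))).head?, x.1 = y.1 → x.2 = y.2 := by
    intro i x hx y hy hxy
    have hy' : y = (none, decide (σ (i + 1) = 1)) := by simpa [block] using hy.symm
    subst hy'
    exact block_junction (p' := (σ (i + 1), u (i + 1))) (h i) x hx hxy
  obtain ⟨m, rfl⟩ := Nat.exists_eq_succ_of_ne_zero (NeZero.ne k)
  constructor
  · rw [blocks, List.flatMap_def, FreeGroup.IsReduced, List.isChain_flatten (by simp [block])]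
    constructor
    · simp only [List.mem_map, List.mem_ofFn]
      rintro _ ⟨_, ⟨i, rfl⟩, rfl⟩
      exact isReduced_block _
    · rw [List.map_ofFn, List.isChain_iff_getElem]
      intro i hi
      simp only [List.length_ofFn] at hi
      simp only [List.getElem_ofFn, Function.comp_apply]
      have : (⟨i + 1, hi⟩ : Fin (m + 1)) = ⟨i, by omega⟩ + 1 := by
        apply Fin.ext
        rw [Fin.val_add_one_of_lt (by rw [Fin.lt_def]; simp; omega)]
      rw [this]
      exact hjoin _
  · intro x hx y hy
    refine hjoin (Fin.last m) x ?_ y ?_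
    · rw [List.ofFn_succ', List.concat_eq_append, blocks_append] at hx
      have hne : block (σ (Fin.last m), u (Fin.last m)) ≠ [] := by simp [block]
      simpa [blocks, List.getLast?_append_of_ne_nil _ hne] using hx
    · rw [List.ofFn_succ, blocks_cons] at hy
      simpa [block] using hy

/-- Reduced `q`-words that are conjugate in the free product of `F(X)` and `⟨q⟩` are rotations of
each other. -/
theorem exists_rotation_of_isConj_qWord {k : ℕ} [NeZero k] {σ : Fin k → ℤˣ}
    {u v : Fin k → FreeGroup X} (hu : Reduced σ u) (hv : Reduced σ v)
    (h : IsConj (qWord (FreeGroup.map some) (FreeGroup.of none) σ u)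
      (qWord (FreeGroup.map some) (FreeGroup.of none) σ v)) :
    ∃ s : Fin k, ∀ i, σ (i + s) = σ i ∧ u (i + s) = v i := by
  rw [← mk_blocks_ofFn, ← mk_blocks_ofFn] at h
  have hrot := isRotated_of_blocks ((isCyclicallyReduced_blocks hu).isRotated_of_isConj
    (isCyclicallyReduced_blocks hv) h)
  obtain ⟨n, hn⟩ := hrot
  refine ⟨Fin.ofNat k n, fun i => ?_⟩
  have hi0 : (i : ℕ) < (List.ofFn fun i => (σ i, u i)).length := by simp
  have := List.getElem?_rotate (n := n) hi0
  rw [hn, List.length_ofFn] at this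
  have hlt : ((i : ℕ) + n) % k < k := Nat.mod_lt _ (NeZero.pos k)
  rw [List.getElem?_ofFn, List.getElem?_ofFn, dif_pos hlt, dif_pos i.2] at this
  have hi : i + Fin.ofNat k n = ⟨((i : ℕ) + n) % k, hlt⟩ := by
    apply Fin.ext
    simp [Fin.val_add, Fin.ofNat]
  rw [hi]
  simpa [eq_comm] using this

end block

end Miller

/-! ### Twists, rotations and unique roots -/

namespace Miller

variable {X : Type*}

/-- The effect on the tuple `u` of `q ↦ a⁻¹ q b`, applied to the cyclic word
`q^{σ₁} u₁ ⋯ q^{σₖ} uₖ`. -/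
def twist {k : ℕ} [NeZero k] (σ : Fin k → ℤˣ) (a b : FreeGroup X) (u : Fin k → FreeGroup X) :
    Fin k → FreeGroup X :=
  fun i => (if σ i = 1 then b else a) * u i * (if σ (i + 1) = 1 then a else b)⁻¹

theorem neg_one_ne_one_units : (-1 : ℤˣ) ≠ 1 := by decide

/-- With `a = w` and `b = wε` the four sign cases become one formula, which makes list conjugacy an
action of pairs. -/
theorem witness_iff {R : Finset (FreeGroup X)} {k : ℕ} [NeZero k] {σ : Fin k → ℤˣ}
    {u v : Fin k → FreeGroup X} {w ε : FreeGroup X} :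
    Witness R σ u v w ε ↔
      PresentedGroup.mk (R : Set (FreeGroup X)) ε = 1 ∧ v = twist σ w (w * ε) u := by
  rw [Witness, funext_iff]
  refine and_congr_right fun _ => forall_congr' fun i => ?_
  rw [twist]
  rcases Int.units_eq_one_or (σ i) with h1 | h1 <;>
    rcases Int.units_eq_one_or (σ (i + 1)) with h2 | h2 <;>
    simp [h1, h2, neg_one_ne_one_units.symm, mul_assoc, eq_comm]

theorem twist_twist {k : ℕ} [NeZero k] (σ : Fin k → ℤˣ) (a b a' b' : FreeGroup X)
    (u : Fin k → FreeGroup X) :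
    twist σ a b (twist σ a' b' u) = twist σ (a * a') (b * b') u := by
  funext i
  simp only [twist]
  split_ifs <;> group

theorem twist_one {k : ℕ} [NeZero k] (σ : Fin k → ℤˣ) (u : Fin k → FreeGroup X) :
    twist σ 1 1 u = u := by
  funext i
  simp [twist]

theorem Reduced.twist {k : ℕ} [NeZero k] {σ : Fin k → ℤˣ} {u : Fin k → FreeGroup X}
    (h : Reduced σ u) (a b : FreeGroup X) : Reduced σ (twist σ a b u) := by
  intro i hi hc
  apply h i hi
  rcases Int.units_eq_one_or (σ (i + 1)) with h2 | h2 <;>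
    simpa [Miller.twist, hi, h2, neg_one_ne_one_units, neg_one_ne_one_units.symm] using hc

theorem twist_rotate {k : ℕ} [NeZero k] {σ : Fin k → ℤˣ} {s : Fin k} (hs : ∀ i, σ (i + s) = σ i)
    (a b : FreeGroup X) (u : Fin k → FreeGroup X) (i : Fin k) :
    twist σ a b u (i + s) = twist σ a b (fun j => u (j + s)) i := by
  simp only [twist, hs, add_right_comm i s 1]

/-- If a rotation of a twist of `v` is `v`, then the twist itself is `v`: roots in free groups are
unique. -/
theorem twist_eq_self {k : ℕ} [NeZero k] {σ : Fin k → ℤˣ} {s : Fin k}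
    (hs : ∀ i, σ (i + s) = σ i) {c d : FreeGroup X} {v : Fin k → FreeGroup X}
    (h : ∀ i, twist σ c d v (i + s) = v i) : twist σ c d v = v := by
  have hv : (fun j => twist σ c d v (j + s)) = v := funext h
  -- Twists commute with `σ`-preserving rotations, so the hypothesis can be iterated; after `k`
  -- steps the rotation by `k • s = 0` disappears.
  have key : ∀ m : ℕ, ∀ i, twist σ (c ^ m) (d ^ m) v (i + m • s) = v i := by
    intro m
    induction m with
    | zero => intro i; simp [twist_one]
    | succ m ih =>
      intro i
      rw [pow_succ, pow_succ, ← twist_twist, succ_nsmul, ← add_assoc, twist_rotate hs, hv]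
      exact ih i
  funext i
  have hk : k • s = 0 := by simpa using card_nsmul_eq_zero (x := s)
  have := key k i
  rw [hk, add_zero] at this
  have conv : ∀ e f : FreeGroup X, e * v i * f⁻¹ = v i ↔ (v i)⁻¹ * e * v i = f := by
    intro e f
    rw [mul_inv_eq_iff_eq_mul, mul_assoc (v i)⁻¹, inv_mul_eq_iff_eq_mul]
  -- The equation for `k`-th powers says that a conjugate of one of `c`, `d` and one of `c`, `d`
  -- have equal `k`-th powers; roots in a free group are unique.
  have hp : ∀ e f : FreeGroup X, ((v i)⁻¹ * e * v i) ^ k = f ^ k → (v i)⁻¹ * e * v i = f :=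
    fun e f hef => pow_left_injective (NeZero.ne k) hef
  have hc : ∀ e : FreeGroup X, ((v i)⁻¹ * e * v i) ^ k = (v i)⁻¹ * e ^ k * v i := by
    intro e
    simpa using conj_pow (a := (v i)⁻¹) (b := e) (i := k)
  simp only [twist] at this ⊢
  rw [← apply_ite (fun x => x ^ k), ← apply_ite (fun x => x ^ k), conv, ← hc] at this
  exact (conv _ _).2 (hp _ _ this)

section

variable {H : Type*} [Group H]

theorem prod_ofFn_conj {n : ℕ} (l : Fin (n + 1) → H) (g : Fin n → H) :
    (List.ofFn fun i : Fin n => (l i.castSucc)⁻¹ * g i * l i.succ).prod =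
      (l 0)⁻¹ * (List.ofFn g).prod * l (Fin.last n) := by
  induction n with
  | zero => simp
  | succ n ih =>
    rw [List.ofFn_succ, List.prod_cons, List.ofFn_succ (f := g), List.prod_cons]
    have := ih (fun i => l i.succ) (fun i => g i.succ)
    simp only [Fin.succ_castSucc] at this
    simp only [this]
    simp [mul_assoc]

theorem prod_ofFn_conj_cyclic {k : ℕ} [NeZero k] (l g : Fin k → H) :
    (List.ofFn fun i : Fin k => (l i)⁻¹ * g i * l (i + 1)).prod =
      (l 0)⁻¹ * (List.ofFn g).prod * l 0 := by
  obtain ⟨m, rfl⟩ := Nat.exists_eq_succ_of_ne_zero (NeZero.ne k)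
  have := prod_ofFn_conj (Fin.snoc l (l 0) : Fin (m + 1 + 1) → H) g
  have h0 : (Fin.snoc l (l 0) : Fin (m + 1 + 1) → H) 0 = l 0 :=
    Fin.snoc_castSucc (α := fun _ => H) (i := (0 : Fin (m + 1))) (l 0) l
  rw [h0, Fin.snoc_last] at this
  rw [← this]
  congr 2
  funext i
  rw [Fin.snoc_castSucc]
  congr 1
  induction i using Fin.lastCases with
  | last => rw [Fin.last_add_one, Fin.succ_last, Fin.snoc_last]
  | cast i =>
    rw [Fin.coeSucc_eq_succ, Fin.succ_castSucc, Fin.snoc_castSucc]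

/-- Each `q` becomes `a⁻¹ q b` and each `q⁻¹` becomes `b⁻¹ q⁻¹ a`. The left factor of a syllable is
moved into the entry before it; cyclically, the first one remains as a conjugating factor. -/
theorem map_qWord_eq_twist (Φ : H →* H) (β : FreeGroup X →* H) (q : H) (a b : FreeGroup X)
    (hβ : ∀ g, Φ (β g) = β g) (hq : Φ q = (β a)⁻¹ * q * β b) {k : ℕ} [NeZero k]
    (σ : Fin k → ℤˣ) (u : Fin k → FreeGroup X) :
    Φ (qWord β q σ u) = (β (if σ 0 = 1 then a else b))⁻¹ * qWord β q σ (twist σ a b u) *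
      β (if σ 0 = 1 then a else b) := by
  have := prod_ofFn_conj_cyclic (fun i => β (if σ i = 1 then a else b))
    (fun i => q ^ ((σ i : ℤˣ) : ℤ) * β (twist σ a b u i))
  rw [qWord, qWord, ← this, map_list_prod, List.map_ofFn]
  congr 2
  funext i
  simp only [Function.comp_apply, map_mul, map_zpow, hβ, hq, twist]
  rcases Int.units_eq_one_or (σ i) with h1 | h1 <;>
    rcases Int.units_eq_one_or (σ (i + 1)) with h2 | h2 <;>
    simp [h1, h2, mul_assoc]

/-- The conjugating prefix is kept explicit because its length enters the upper bound. -/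
theorem qWord_rotate (β : FreeGroup X →* H) (q : H) {k : ℕ} [NeZero k] {σ : Fin k → ℤˣ}
    {s : Fin k} (hs : ∀ i, σ (i + s) = σ i) (u : Fin k → FreeGroup X) :
    qWord β q σ (fun i => u (i + s)) =
      (((List.ofFn fun i => q ^ ((σ i : ℤˣ) : ℤ) * β (u i)).take s).prod)⁻¹ * qWord β q σ u *
      ((List.ofFn fun i => q ^ ((σ i : ℤˣ) : ℤ) * β (u i)).take s).prod := by
  set L := List.ofFn fun i => q ^ ((σ i : ℤˣ) : ℤ) * β (u i) with hL
  have hrot : (List.ofFn fun i => q ^ ((σ i : ℤˣ) : ℤ) * β (u (i + s))) = L.rotate s := by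
    apply List.ext_getElem
    · simp [hL]
    · intro i h1 h2
      rw [List.getElem_rotate]
      simp only [hL, List.getElem_ofFn, List.length_ofFn]
      have hi : i < k := by simpa using h1
      have : (⟨(i + s) % k, Nat.mod_lt _ (NeZero.pos k)⟩ : Fin k) = ⟨i, hi⟩ + s := by
        apply Fin.ext
        simp [Fin.val_add]
      rw [this, hs]
  have hle : (s : ℕ) ≤ L.length := by simp [hL]
  rw [qWord, hrot, List.rotate_eq_drop_append_take hle, List.prod_append, qWord, ← hL]
  conv_rhs => enter [1, 2]; rw [← List.take_append_drop s L, List.prod_append]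
  group

end

end Miller

/-! ### Representation of the Miller machine in a semidirect product -/

namespace Miller

variable {X : Type*}

/-- The endomorphism of the free product of `F(X)` and `⟨q⟩` that fixes `X` and sends `q` to
`a⁻¹ q b`. -/
def twistEnd (p : FreeGroup X × FreeGroup X) : FreeGroup (Option X) →* FreeGroup (Option X) :=
  FreeGroup.lift fun o => o.elim
    ((FreeGroup.map some p.1)⁻¹ * FreeGroup.of none * FreeGroup.map some p.2)
    fun x => FreeGroup.of (some x)

theorem twistEnd_map (p : FreeGroup X × FreeGroup X) (g : FreeGroup X) :
    twistEnd p (FreeGroup.map some g) = FreeGroup.map some g := by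
  have : (twistEnd p).comp (FreeGroup.map some) = FreeGroup.map (some : X → Option X) := by
    ext x
    simp [twistEnd]
  exact DFunLike.congr_fun this g

theorem twistEnd_none (p : FreeGroup X × FreeGroup X) :
    twistEnd p (FreeGroup.of none) =
      (FreeGroup.map some p.1)⁻¹ * FreeGroup.of none * FreeGroup.map some p.2 := by
  simp [twistEnd]

/-- The order of factors is preserved because the inserted words lie in `F(X)`, which is fixed. -/
theorem twistEnd_comp (p p' : FreeGroup X × FreeGroup X) :
    (twistEnd p).comp (twistEnd p') = twistEnd (p * p') := by
  ext o
  cases o with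
  | none =>
    simp only [MonoidHom.comp_apply, twistEnd_none, map_mul, map_inv, twistEnd_map, Prod.fst_mul,
      Prod.snd_mul]
    group
  | some x => simp [twistEnd]

theorem twistEnd_one : twistEnd (1 : FreeGroup X × FreeGroup X) = MonoidHom.id _ := by
  ext o
  cases o <;> simp [twistEnd]

/-- The action of `F(X) × F(X)` on the free product of `F(X)` and `⟨q⟩` by `q ↦ a⁻¹ q b`. -/
def twistAut : FreeGroup X × FreeGroup X →* MulAut (FreeGroup (Option X)) where
  toFun p := MonoidHom.toMulEquiv (twistEnd p) (twistEnd p⁻¹)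
    (by rw [twistEnd_comp, inv_mul_cancel, twistEnd_one])
    (by rw [twistEnd_comp, mul_inv_cancel, twistEnd_one])
  map_one' := by
    ext1 z
    exact DFunLike.congr_fun twistEnd_one z
  map_mul' p p' := by
    ext1 z
    exact (DFunLike.congr_fun (twistEnd_comp p p') z).symm

theorem twistAut_apply (p : FreeGroup X × FreeGroup X) (z : FreeGroup (Option X)) :
    twistAut p z = twistEnd p z := rfl

variable (R : Finset (FreeGroup X))

/-- The images of the generators of the Miller machine in the semidirect product. -/
def repGen : Gen R → FreeGroup (Option X) ⋊[twistAut] (FreeGroup X × FreeGroup X)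
  | .base x => SemidirectProduct.inl (FreeGroup.of (some x))
  | .theta (Sum.inl x) => SemidirectProduct.inr (FreeGroup.of x, FreeGroup.of x)
  | .theta (Sum.inr r) => SemidirectProduct.inr (1, r)
  | .q => SemidirectProduct.inl (FreeGroup.of none)

theorem lift_repGen_baseF (g : FreeGroup X) :
    FreeGroup.lift (repGen R) (baseF R g) = SemidirectProduct.inl (FreeGroup.map some g) := by
  have : (FreeGroup.lift (repGen R)).comp (baseF R) =
      SemidirectProduct.inl.comp (FreeGroup.map some) := by
    ext1 x
    simp [baseF, repGen]
  exact DFunLike.congr_fun this g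

theorem lift_repGen_relators : ∀ g ∈ relators R, FreeGroup.lift (repGen R) g = 1 := by
  rintro g (⟨α, x, rfl⟩ | ⟨x, rfl⟩ | ⟨r, rfl⟩) <;>
    rw [map_mul, map_inv, mul_inv_eq_one] <;> simp only [map_mul, lift_repGen_baseF, thetaF, qF,
      FreeGroup.lift_apply_of]
  · have key : ∀ p : FreeGroup X × FreeGroup X,
        (SemidirectProduct.inr p : FreeGroup (Option X) ⋊[twistAut] _) *
          SemidirectProduct.inl (FreeGroup.map some (FreeGroup.of x)) =
        SemidirectProduct.inl (FreeGroup.map some (FreeGroup.of x)) * SemidirectProduct.inr p := by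
      intro p
      ext1
      · simp [twistAut_apply, twistEnd]
      · simp
    rcases α with y | r <;> exact key _
  · ext1
    · simp [repGen, twistAut_apply, twistEnd, ← mul_assoc]
    · simp [repGen]
  · ext1
    · simp [repGen, twistAut_apply, twistEnd]
    · simp [repGen]

/-- The Miller machine maps to the semidirect product of the free product of `F(X)` and `⟨q⟩`
with `F(X) × F(X)`. -/
def rep : Machine R →* FreeGroup (Option X) ⋊[twistAut] (FreeGroup X × FreeGroup X) :=
  PresentedGroup.toGroup (lift_repGen_relators R)

theorem rep_mk (g : FreeGroup (Gen R)) :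
    rep R (PresentedGroup.mk (relators R) g) = FreeGroup.lift (repGen R) g := rfl

theorem rep_baseM (g : FreeGroup X) :
    rep R (baseM R g) = SemidirectProduct.inl (FreeGroup.map some g) := lift_repGen_baseF R g

theorem rep_qM : rep R (qM R) = SemidirectProduct.inl (FreeGroup.of none) := by
  rw [qM, rep_mk]
  simp [qF, repGen]

theorem rep_qElem {k : ℕ} (σ : Fin k → ℤˣ) (u : Fin k → FreeGroup X) :
    rep R (qElem R σ u) =
      SemidirectProduct.inl (qWord (FreeGroup.map some) (FreeGroup.of none) σ u) := by
  rw [qElem_eq_qWord, map_qWord, map_qWord, rep_qM]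
  congr 1
  ext1 g
  simp [rep_baseM]

theorem mk_eq_one_of_mem {r : FreeGroup X} (hr : r ∈ R) :
    PresentedGroup.mk (R : Set (FreeGroup X)) r = 1 :=
  PresentedGroup.one_of_mem (Finset.mem_coe.2 hr)

/-- The two components of the image in `F(X) × F(X)` agree in `G`. -/
theorem mk_rep_fst (γ : Machine R) :
    PresentedGroup.mk (R : Set (FreeGroup X)) (rep R γ).right.1 =
      PresentedGroup.mk (R : Set (FreeGroup X)) (rep R γ).right.2 := by
  let f : Machine R →* FreeGroup X × FreeGroup X := SemidirectProduct.rightHom.comp (rep R)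
  have : ((PresentedGroup.mk (R : Set (FreeGroup X))).comp (MonoidHom.fst _ _)).comp f =
      ((PresentedGroup.mk (R : Set (FreeGroup X))).comp (MonoidHom.snd _ _)).comp f := by
    apply PresentedGroup.ext
    rintro (x | (x | r) | _)
    all_goals
      simp only [MonoidHom.comp_apply, f, PresentedGroup.of, SemidirectProduct.rightHom_eq_right]
      rw [rep_mk]
      simp [repGen]
    -- Only `θ_r ↦ (1, r)` has differing components, and `r =_G 1`.
    exact (mk_eq_one_of_mem R r.2).symm
  exact DFunLike.congr_fun this γ

theorem semidirect_conj_inl {N G : Type*} [Group N] [Group G] {φ : G →* MulAut N}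
    (x : N ⋊[φ] G) (z : N) :
    x * SemidirectProduct.inl z * x⁻¹ =
      SemidirectProduct.inl (x.left * φ x.right z * x.left⁻¹) := by
  ext <;> simp

section conj

variable {R} [DecidableEq X]

/-- Conjugate reduced `q`-words in the Miller machine are related by a twist and a rotation. -/
theorem exists_rotation_twist {k : ℕ} [NeZero k] {σ : Fin k → ℤˣ} {u v : Fin k → FreeGroup X}
    (hu : Reduced σ u) (hv : Reduced σ v) {γ : Machine R}
    (h : γ * qElem R σ u * γ⁻¹ = qElem R σ v) :
    ∃ s : Fin k, (∀ i, σ (i + s) = σ i) ∧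
      ∀ i, twist σ (rep R γ).right.1 (rep R γ).right.2 u (i + s) = v i := by
  have h' := congrArg (rep R) h
  rw [map_mul, map_mul, map_inv, rep_qElem, rep_qElem] at h'
  set p := (rep R γ).right with hp
  rw [semidirect_conj_inl, ← hp, SemidirectProduct.inl_inj, twistAut_apply,
    map_qWord_eq_twist (twistEnd p) _ _ p.1 p.2 (twistEnd_map p) (twistEnd_none p)] at h'
  obtain ⟨s, hs⟩ := exists_rotation_of_isConj_qWord (hu.twist p.1 p.2) hv (by
    rw [isConj_iff]
    -- The second factor undoes the conjugating factor left over by the twist.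
    refine ⟨(rep R γ).left * (FreeGroup.map some (if σ 0 = 1 then p.1 else p.2))⁻¹, ?_⟩
    rw [← h']
    group)
  exact ⟨s, fun i => (hs i).1, fun i => (hs i).2⟩

end conj

end Miller

/-! ### Word length and lifting pairs to the Miller machine -/

namespace Miller

variable {X : Type*} {R : Finset (FreeGroup X)}

section length

theorem machineLength_mk_le (L : List (Gen R × Bool)) :
    machineLength R (PresentedGroup.mk (relators R) (FreeGroup.mk L)) ≤ L.length :=
  Nat.sInf_le ⟨L, rfl, rfl⟩

theorem exists_list_of_machineLength (g : Machine R) :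
    ∃ L : List (Gen R × Bool), L.length = machineLength R g ∧
      PresentedGroup.mk (relators R) (FreeGroup.mk L) = g := by
  refine Nat.sInf_mem (s := {n | ∃ L : List (Gen R × Bool),
    L.length = n ∧ PresentedGroup.mk (relators R) (FreeGroup.mk L) = g}) ?_
  obtain ⟨z, hz⟩ := PresentedGroup.mk_surjective (relators R) g
  obtain ⟨L⟩ := z
  exact ⟨_, L, rfl, hz⟩

theorem machineLength_one : machineLength R 1 = 0 :=
  Nat.le_zero.1 (machineLength_mk_le (R := R) [])

theorem machineLength_mul_le (g h : Machine R) :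
    machineLength R (g * h) ≤ machineLength R g + machineLength R h := by
  obtain ⟨L, hL, rfl⟩ := exists_list_of_machineLength g
  obtain ⟨L', hL', rfl⟩ := exists_list_of_machineLength h
  rw [← map_mul, FreeGroup.mul_mk, ← hL, ← hL', ← List.length_append]
  exact machineLength_mk_le _

theorem machineLength_inv_le (g : Machine R) : machineLength R g⁻¹ ≤ machineLength R g := by
  obtain ⟨L, hL, rfl⟩ := exists_list_of_machineLength g
  rw [← map_inv, FreeGroup.inv_mk, ← hL, ← FreeGroup.invRev_length (L₁ := L)]
  exact machineLength_mk_le _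

theorem machineLength_prod_le (l : List (Machine R)) :
    machineLength R l.prod ≤ (l.map (machineLength R)).sum := by
  induction l with
  | nil => simp [machineLength_one]
  | cons a l ih =>
    rw [List.prod_cons, List.map_cons, List.sum_cons]
    exact (machineLength_mul_le _ _).trans (by gcongr)

theorem machineLength_of_le (a : Gen R) :
    machineLength R (PresentedGroup.mk (relators R) (FreeGroup.of a)) ≤ 1 :=
  machineLength_mk_le [(a, true)]

theorem machineLength_qM_zpow_le (s : ℤˣ) : machineLength R (qM R ^ (s : ℤ)) ≤ 1 := by
  rcases Int.units_eq_one_or s with rfl | rfl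
  · rw [Units.val_one, zpow_one]
    exact machineLength_of_le Gen.q
  · rw [Units.val_neg, Units.val_one, zpow_neg_one]
    exact (machineLength_inv_le _).trans (machineLength_of_le (R := R) Gen.q)

variable [DecidableEq X]

theorem machineLength_map_le (f : X → Gen R) (g : FreeGroup X) :
    machineLength R (PresentedGroup.mk (relators R) (FreeGroup.map f g)) ≤ g.norm := by
  conv_lhs => rw [← FreeGroup.mk_toWord (x := g), FreeGroup.map.mk]
  refine (machineLength_mk_le _).trans ?_
  rw [List.length_map]
  rfl

theorem machineLength_baseM_le (g : FreeGroup X) : machineLength R (baseM R g) ≤ g.norm :=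
  machineLength_map_le _ g

/-- The projection to the first factor of `F(X) × F(X)` does not increase lengths. -/
theorem norm_rep_fst_le (γ : Machine R) : (rep R γ).right.1.norm ≤ machineLength R γ := by
  obtain ⟨L, hL, rfl⟩ := exists_list_of_machineLength γ
  rw [← hL, rep_mk]
  clear hL
  have hgen : ∀ a : Gen R, (repGen R a).right.1.norm ≤ 1 := by
    rintro (x | (x | r) | _) <;> simp [repGen]
  induction L with
  | nil => simp [← FreeGroup.one_eq_mk]
  | cons a L ih =>
    rw [← List.singleton_append, ← FreeGroup.mul_mk, map_mul, SemidirectProduct.mul_right,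
      Prod.fst_mul]
    refine (FreeGroup.norm_mul_le _ _).trans ?_
    rw [List.length_append, List.length_singleton]
    refine add_le_add ?_ ih
    obtain ⟨a, b⟩ := a
    cases b
    · simpa [FreeGroup.lift_mk] using hgen a
    · simpa [FreeGroup.lift_mk] using hgen a

end length

section acts

/-- Conjugation by `γ` fixes `X` and maps `q` to `a⁻¹ q b`. -/
def Acts (γ : Machine R) (a b : FreeGroup X) : Prop :=
  (∀ g, γ * baseM R g * γ⁻¹ = baseM R g) ∧
    γ * qM R * γ⁻¹ = (baseM R a)⁻¹ * qM R * baseM R b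

theorem acts_one : Acts (1 : Machine R) 1 1 := by simp [Acts]

theorem Acts.mul {γ γ' : Machine R} {a b a' b' : FreeGroup X} (h : Acts γ a b)
    (h' : Acts γ' a' b') : Acts (γ * γ') (a * a') (b * b') := by
  have e : ∀ z, γ * γ' * z * (γ * γ')⁻¹ = γ * (γ' * z * γ'⁻¹) * γ⁻¹ := fun z => by group
  refine ⟨fun g => by rw [e, h'.1, h.1], ?_⟩
  rw [e, h'.2]
  calc γ * ((baseM R a')⁻¹ * qM R * baseM R b') * γ⁻¹
      = (γ * baseM R a' * γ⁻¹)⁻¹ * (γ * qM R * γ⁻¹) * (γ * baseM R b' * γ⁻¹) := by group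
    _ = _ := by rw [h.1, h.1, h.2, map_mul, map_mul]; group

theorem Acts.inv {γ : Machine R} {a b : FreeGroup X} (h : Acts γ a b) : Acts γ⁻¹ a⁻¹ b⁻¹ := by
  have h1 : ∀ g, γ⁻¹ * baseM R g * γ⁻¹⁻¹ = baseM R g := by
    intro g
    conv_lhs => rw [← h.1 g]
    group
  refine ⟨h1, ?_⟩
  have : qM R = baseM R a * (γ * qM R * γ⁻¹) * (baseM R b)⁻¹ := by rw [h.2]; group
  calc γ⁻¹ * qM R * γ⁻¹⁻¹
      = γ⁻¹ * (baseM R a * (γ * qM R * γ⁻¹) * (baseM R b)⁻¹) * γ⁻¹⁻¹ := by rw [← this]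
    _ = (γ⁻¹ * baseM R a * γ⁻¹⁻¹) * qM R * (γ⁻¹ * baseM R b * γ⁻¹⁻¹)⁻¹ := by group
    _ = _ := by rw [h1, h1, map_inv, map_inv, inv_inv]

/-- The letter `θ_α` in the Miller machine. -/
def thetaM (R : Finset (FreeGroup X)) (α : X ⊕ {r // r ∈ R}) : Machine R :=
  PresentedGroup.mk (relators R) (thetaF R α)

theorem thetaM_comm (α : X ⊕ {r // r ∈ R}) (g : FreeGroup X) :
    thetaM R α * baseM R g * (thetaM R α)⁻¹ = baseM R g := by
  have : ((MulAut.conj (thetaM R α)).toMonoidHom.comp (baseM R)) = baseM R := by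
    ext1 x
    have hx := PresentedGroup.one_of_mem (rels := relators R) (Or.inl ⟨α, x, rfl⟩)
    rw [map_mul, map_inv, mul_inv_eq_one, map_mul, map_mul] at hx
    rw [MonoidHom.comp_apply]
    exact mul_inv_eq_iff_eq_mul.2 hx
  exact DFunLike.congr_fun this g

/-- Since `θ_x` commutes with `x`, the relation `θ_x x q = q x θ_x` reads `x θ_x q = q x θ_x`, that
is `θ_x q θ_x⁻¹ = x⁻¹ q x`. -/
theorem acts_thetaM_inl (x : X) :
    Acts (thetaM R (Sum.inl x)) (FreeGroup.of x) (FreeGroup.of x) := by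
  refine ⟨thetaM_comm _, ?_⟩
  have hx := PresentedGroup.one_of_mem (rels := relators R) (Or.inr (Or.inl ⟨x, rfl⟩))
  rw [map_mul, map_inv, mul_inv_eq_one, map_mul, map_mul, map_mul, map_mul] at hx
  change thetaM R _ * baseM R _ * qM R = qM R * baseM R _ * thetaM R _ at hx
  have hc := mul_inv_eq_iff_eq_mul.1 (thetaM_comm (R := R) (Sum.inl x) (FreeGroup.of x))
  rw [hc] at hx
  rw [mul_inv_eq_iff_eq_mul, mul_assoc, mul_assoc, eq_inv_mul_iff_mul_eq, ← mul_assoc, hx,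
    mul_assoc]

theorem acts_thetaM_inr (r : {r // r ∈ R}) : Acts (thetaM R (Sum.inr r)) 1 r := by
  refine ⟨thetaM_comm _, ?_⟩
  have hx := PresentedGroup.one_of_mem (rels := relators R) (Or.inr (Or.inr ⟨r, rfl⟩))
  rw [map_mul, map_inv, mul_inv_eq_one, map_mul, map_mul, map_mul] at hx
  rw [map_one, inv_one, one_mul]
  exact mul_inv_eq_iff_eq_mul.2 hx

theorem acts_map_theta (w : FreeGroup X) :
    Acts (PresentedGroup.mk (relators R) (FreeGroup.map (fun x => Gen.theta (Sum.inl x)) w))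
      w w := by
  induction w using FreeGroup.induction_on with
  | C1 => simpa using acts_one
  | of x => exact acts_thetaM_inl x
  | inv_of x h => simpa using h.inv
  | mul x y hx hy => simpa using hx.mul hy

/-- The transform of a `q`-word under an element of the Miller machine that acts by
`q ↦ a⁻¹ q b`. -/
theorem Acts.conj_qElem {γ : Machine R} {a b : FreeGroup X} (h : Acts γ a b) {k : ℕ} [NeZero k]
    (σ : Fin k → ℤˣ) (u : Fin k → FreeGroup X) :
    γ * qElem R σ u * γ⁻¹ = (baseM R (if σ 0 = 1 then a else b))⁻¹ *
      qElem R σ (twist σ a b u) * baseM R (if σ 0 = 1 then a else b) :=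
  map_qWord_eq_twist (MulAut.conj γ).toMonoidHom (baseM R) (qM R) a b h.1 h.2 σ u

theorem exists_acts_relator {r : FreeGroup X} (hr : r ∈ R ∨ r⁻¹ ∈ R) :
    ∃ γ : Machine R, Acts γ 1 r ∧ machineLength R γ ≤ 1 := by
  rcases hr with hr | hr
  · exact ⟨_, acts_thetaM_inr ⟨r, hr⟩, machineLength_of_le _⟩
  · have h := (acts_thetaM_inr (R := R) ⟨r⁻¹, hr⟩).inv
    rw [inv_one, inv_inv] at h
    exact ⟨_, h, (machineLength_inv_le _).trans (machineLength_of_le _)⟩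

variable [DecidableEq X]

/-- Every `w` lifts to an element of length at most `‖w‖` that acts by `q ↦ w⁻¹ q w`. -/
theorem exists_acts_diagonal (R : Finset (FreeGroup X)) (w : FreeGroup X) :
    ∃ γ : Machine R, Acts γ w w ∧ machineLength R γ ≤ w.norm :=
  ⟨_, acts_map_theta w, machineLength_map_le _ w⟩

/-- A product of conjugates of relators lifts to the Miller machine at its cost. -/
theorem exists_acts_of_product (l : List (FreeGroup X × FreeGroup X))
    (hl : ∀ p ∈ l, p.2 ∈ R ∨ p.2⁻¹ ∈ R) (g : FreeGroup X) :
    ∃ γ : Machine R, Acts γ g⁻¹ (g⁻¹ * (l.map fun p => p.1 * p.2 * p.1⁻¹).prod) ∧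
      machineLength R γ ≤ l.length + pathLength (g :: (l.map Prod.fst ++ [1])) := by
  induction l generalizing g with
  | nil =>
    obtain ⟨γ, h1, h2⟩ := exists_acts_diagonal R g⁻¹
    exact ⟨γ, by simpa using h1, by simpa [pathLength] using h2⟩
  | cons p l ih =>
    -- The lift follows the path from `g` through the `wⱼ` back to `1`: a diagonal element for each
    -- step, and one letter `θ_r^{±1}` at each stop.
    obtain ⟨γ₁, h1, h1'⟩ := exists_acts_diagonal R (g⁻¹ * p.1)
    obtain ⟨γ₂, h2, h2'⟩ := exists_acts_relator (hl p (by simp))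
    obtain ⟨γ₃, h3, h3'⟩ := ih (fun p' hp' => hl p' (by simp [hp'])) p.1
    refine ⟨γ₁ * γ₂ * γ₃, ?_, ?_⟩
    · convert (h1.mul h2).mul h3 using 1
      · simp
      · simp [mul_assoc]
    · have e1 := machineLength_mul_le (γ₁ * γ₂) γ₃
      have e2 := machineLength_mul_le γ₁ γ₂
      simp only [List.map_cons, List.cons_append, List.length_cons, pathLength]
      omega

end acts

end Miller

/-! ### Products of relators and the growth of `Λ` -/

namespace Miller

variable {X : Type*} {R : Finset (FreeGroup X)}

theorem exists_conjLength_eq {x y : Machine R} (h : IsConj x y) :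
    ∃ γ : Machine R, γ * x * γ⁻¹ = y ∧ conjLength R x y = machineLength R γ := by
  refine Nat.sInf_mem (s := {n | ∃ γ : Machine R, γ * x * γ⁻¹ = y ∧ n = machineLength R γ}) ?_
  obtain ⟨γ, hγ⟩ := isConj_iff.1 h
  exact ⟨_, γ, hγ, rfl⟩

/-- Ensures that the infimum defining `λ(g)` is attained rather than being the default `0` of an
empty set. -/
theorem exists_product_of_mk_eq_one {g : FreeGroup X}
    (hg : PresentedGroup.mk (R : Set (FreeGroup X)) g = 1) :
    ∃ l : List (FreeGroup X × FreeGroup X), (∀ p ∈ l, p.2 ∈ R ∨ p.2⁻¹ ∈ R) ∧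
      (l.map fun p => p.1 * p.2 * p.1⁻¹).prod = g := by
  have hmem : g ∈ Subgroup.normalClosure (R : Set (FreeGroup X)) :=
    (QuotientGroup.eq_one_iff g).1 hg
  rw [Subgroup.normalClosure] at hmem
  induction hmem using Subgroup.closure_induction with
  | mem x hx =>
    obtain ⟨r, hr, hc⟩ := Group.mem_conjugatesOfSet_iff.1 hx
    obtain ⟨w, hw⟩ := isConj_iff.1 hc
    exact ⟨[(w, r)], by simpa using Or.inl hr, by simpa using hw⟩
  | one => exact ⟨[], by simp, by simp⟩
  | mul x y hx hy ihx ihy =>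
    obtain ⟨l, h1, h2⟩ := ihx ((QuotientGroup.eq_one_iff x).2 hx)
    obtain ⟨l', h1', h2'⟩ := ihy ((QuotientGroup.eq_one_iff y).2 hy)
    refine ⟨l ++ l', ?_, by simp [h2, h2']⟩
    intro p hp
    rcases List.mem_append.1 hp with hp | hp
    exacts [h1 p hp, h1' p hp]
  | inv x hx ih =>
    obtain ⟨l, h1, h2⟩ := ih ((QuotientGroup.eq_one_iff x).2 hx)
    refine ⟨(l.map fun p => (p.1, p.2⁻¹)).reverse, ?_, ?_⟩
    · intro p hp
      simp only [List.mem_reverse, List.mem_map] at hp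
      obtain ⟨p', hp', rfl⟩ := hp
      simpa using (h1 p' hp').symm
    · rw [← h2, List.prod_inv_reverse, List.map_reverse, List.map_map, List.map_map]
      congr 3
      funext p
      simp [mul_assoc]

variable [DecidableEq X]

section lambda

theorem exists_lambdaLength_eq {g : FreeGroup X}
    (hg : PresentedGroup.mk (R : Set (FreeGroup X)) g = 1) :
    ∃ l : List (FreeGroup X × FreeGroup X), (∀ p ∈ l, p.2 ∈ R ∨ p.2⁻¹ ∈ R) ∧
      (l.map fun p => p.1 * p.2 * p.1⁻¹).prod = g ∧ lambdaLength R g = productCost l := by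
  refine Nat.sInf_mem (s := {m | ∃ l : List (FreeGroup X × FreeGroup X),
    (∀ p ∈ l, p.2 ∈ R ∨ p.2⁻¹ ∈ R) ∧
    (l.map fun p => p.1 * p.2 * p.1⁻¹).prod = g ∧ m = productCost l}) ?_
  obtain ⟨l, h1, h2⟩ := exists_product_of_mk_eq_one hg
  exact ⟨_, l, h1, h2, rfl⟩

theorem two_le_tConst : 2 ≤ tConst R := le_max_left _ _

theorem norm_le_tConst {r : FreeGroup X} (hr : r ∈ R ∨ r⁻¹ ∈ R) : r.norm ≤ tConst R := by
  rcases hr with hr | hr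
  · exact (Finset.le_sup (f := FreeGroup.norm) hr).trans (le_max_right _ _)
  · rw [← FreeGroup.norm_inv_eq]
    exact (Finset.le_sup (f := FreeGroup.norm) hr).trans (le_max_right _ _)

/-- Spelling the product along the path costs the path length plus at most `t` letters for each
relator; the free starting point `g` makes the induction go through. -/
theorem norm_product_le (l : List (FreeGroup X × FreeGroup X))
    (hl : ∀ p ∈ l, p.2 ∈ R ∨ p.2⁻¹ ∈ R) (g : FreeGroup X) :
    (g⁻¹ * (l.map fun p => p.1 * p.2 * p.1⁻¹).prod).norm ≤
      tConst R * l.length + pathLength (g :: (l.map Prod.fst ++ [1])) := by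
  induction l generalizing g with
  | nil => simp [pathLength]
  | cons p l ih =>
    have e := ih (fun p' hp' => hl p' (by simp [hp'])) p.1
    have e2 := norm_le_tConst (hl p (by simp))
    set P := (l.map fun p => p.1 * p.2 * p.1⁻¹).prod with hP
    have : g⁻¹ * ((p :: l).map fun p => p.1 * p.2 * p.1⁻¹).prod =
        g⁻¹ * p.1 * p.2 * (p.1⁻¹ * P) := by
      rw [List.map_cons, List.prod_cons, ← hP]
      group
    rw [this]
    have e3 := FreeGroup.norm_mul_le (g⁻¹ * p.1 * p.2) (p.1⁻¹ * P)
    have e4 := FreeGroup.norm_mul_le (g⁻¹ * p.1) p.2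
    simp only [List.map_cons, List.cons_append, List.length_cons, pathLength, Nat.mul_add]
    omega

theorem norm_le_mul_lambdaLength {g : FreeGroup X}
    (hg : PresentedGroup.mk (R : Set (FreeGroup X)) g = 1) :
    g.norm ≤ tConst R * lambdaLength R g := by
  obtain ⟨l, h1, rfl, h3⟩ := exists_lambdaLength_eq hg
  rw [h3, productCost]
  have e := norm_product_le l h1 1
  rw [inv_one, one_mul] at e
  have ht := two_le_tConst (R := R)
  nlinarith [Nat.zero_le (pathLength (1 :: (l.map Prod.fst ++ [1])))]

variable [Finite X]

theorem lambdaLength_le_LambdaFun {g : FreeGroup X}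
    (hg : PresentedGroup.mk (R : Set (FreeGroup X)) g = 1) {n : ℕ} (hn : g.norm ≤ n) :
    lambdaLength R g ≤ LambdaFun R n := by
  refine le_csSup (Set.Finite.bddAbove ?_) ⟨g, hg, hn, rfl⟩
  refine ((FreeGroup.finite_norm_le (α := X) n).image (lambdaLength R)).subset ?_
  rintro m ⟨g, -, h, rfl⟩
  exact ⟨g, h, rfl⟩

/-- The powers of a nontrivial relator have lengths with bounded gaps. -/
theorem exists_norm_pow_mem {r : FreeGroup X} (hr : r ≠ 1) {t : ℕ} (ht : r.norm ≤ t) (m : ℕ) :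
    ∃ j : ℕ, (r ^ j).norm ≤ m ∧ m < (r ^ j).norm + t := by
  have hex : ∃ j : ℕ, m < (r ^ j).norm := by
    by_contra! hcon
    have hinj : Function.Injective fun j : ℕ => r ^ j :=
      injective_pow_iff_not_isOfFinOrder.2 (not_isOfFinOrder_of_isMulTorsionFree hr)
    exact Set.infinite_range_of_injective hinj
      ((FreeGroup.finite_norm_le (α := X) m).subset (by rintro _ ⟨j, rfl⟩; exact hcon j))
  classical
  obtain ⟨j, hj, hmin⟩ : ∃ j : ℕ, m < (r ^ j).norm ∧ ∀ i < j, (r ^ i).norm ≤ m :=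
    ⟨Nat.find hex, Nat.find_spec hex, fun i hi => not_lt.1 (Nat.find_min hex hi)⟩
  cases j with
  | zero => simp at hj
  | succ j =>
    refine ⟨j, hmin j (Nat.lt_succ_self j), ?_⟩
    rw [pow_succ] at hj
    have := FreeGroup.norm_mul_le (r ^ j) r
    omega

/-- `Λ` grows at least linearly if some relator is nontrivial. -/
theorem le_mul_LambdaFun (hR : ∃ r ∈ R, r ≠ 1) {m : ℕ} (hm : tConst R ≤ m) :
    m ≤ 2 * tConst R ^ 2 * LambdaFun R m := by
  obtain ⟨r, hr, hr1⟩ := hR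
  obtain ⟨j, h1, h2⟩ := exists_norm_pow_mem hr1 (norm_le_tConst (Or.inl hr)) m
  have hg : PresentedGroup.mk (R : Set (FreeGroup X)) (r ^ j) = 1 := by
    rw [map_pow, mk_eq_one_of_mem R hr, one_pow]
  have h3 := (norm_le_mul_lambdaLength hg).trans
    (Nat.mul_le_mul_left (tConst R) (lambdaLength_le_LambdaFun hg h1))
  -- If `Λ(m) = 0`, then `r ^ j` has length `0`, so `m < t`, against `hm`.
  have hL : 1 ≤ LambdaFun R m := by
    by_contra! h0
    have h0' : LambdaFun R m = 0 := by omega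
    rw [h0', mul_zero] at h3
    omega
  have ht := two_le_tConst (R := R)
  have : m ≤ tConst R * LambdaFun R m + tConst R := by omega
  nlinarith [Nat.mul_le_mul ht (le_refl (tConst R * LambdaFun R m)),
    Nat.mul_le_mul_left (tConst R) hL]

end lambda

/-! ### Witnesses versus conjugators: the lower bound -/

section length

theorem totalLength_eq {k : ℕ} (u v : Fin k → FreeGroup X) :
    totalLength u v = ∑ i, (u i).norm + ∑ i, (v i).norm := Finset.sum_add_distrib

theorem finite_totalLength_le [Finite X] (k n : ℕ) :
    {p : (Fin k → FreeGroup X) × (Fin k → FreeGroup X) | totalLength p.1 p.2 ≤ n}.Finite := by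
  have h : (Set.univ.pi fun _ : Fin k => {g : FreeGroup X | g.norm ≤ n}).Finite :=
    Set.Finite.pi fun _ => FreeGroup.finite_norm_le n
  refine (h.prod h).subset ?_
  rintro ⟨u, v⟩ huv
  have huv' : totalLength u v ≤ n := huv
  rw [totalLength] at huv'
  have key : ∀ i, (u i).norm + (v i).norm ≤ n := fun i =>
    (Finset.single_le_sum (f := fun i => (u i).norm + (v i).norm) (fun _ _ => Nat.zero_le _)
      (Finset.mem_univ i)).trans huv'
  exact ⟨fun i _ => (Nat.le_add_right _ _).trans (key i),
    fun i _ => (Nat.le_add_left _ _).trans (key i)⟩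

variable {k : ℕ} [NeZero k] {σ : Fin k → ℤˣ} {u v : Fin k → FreeGroup X}

theorem listConjLength_le_CFun [Finite X] (h : ListConj R σ u v) {n : ℕ}
    (hn : totalLength u v ≤ n) : listConjLength R σ u v ≤ CFun R σ n := by
  refine le_csSup (Set.Finite.bddAbove ?_) ⟨u, v, h, hn, rfl⟩
  refine ((finite_totalLength_le k n).image fun p => listConjLength R σ p.1 p.2).subset ?_
  rintro m ⟨u, v, -, h, rfl⟩
  exact ⟨(u, v), h, rfl⟩

theorem conjLength_le_DFun [Finite X] (hu : Reduced σ u) (hv : Reduced σ v)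
    (h : IsConj (qElem R σ u) (qElem R σ v)) {n : ℕ} (hn : totalLength u v + 2 * k ≤ n) :
    conjLength R (qElem R σ u) (qElem R σ v) ≤ DFun R σ n := by
  refine le_csSup (Set.Finite.bddAbove ?_) ⟨u, v, hu, hv, h, hn, rfl⟩
  refine ((finite_totalLength_le k n).image
    fun p => conjLength R (qElem R σ p.1) (qElem R σ p.2)).subset ?_
  rintro m ⟨u, v, -, -, -, h, rfl⟩
  exact ⟨(u, v), show totalLength u v ≤ n by omega, rfl⟩

theorem exists_listConjLength_eq (h : ListConj R σ u v) :
    ∃ w ε, Witness R σ u v w ε ∧ listConjLength R σ u v = w.norm := by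
  refine Nat.sInf_mem (s := {m | ∃ w ε, Witness R σ u v w ε ∧ m = w.norm}) ?_
  obtain ⟨-, -, w, ε, h⟩ := h
  exact ⟨_, w, ε, h, rfl⟩

/-- A witness for list conjugacy lifts to the Miller machine. -/
theorem Witness.exists_acts {w ε : FreeGroup X} (h : Witness R σ u v w ε) :
    ∃ γ : Machine R, Acts γ w (w * ε) ∧ v = twist σ w (w * ε) u ∧
      machineLength R γ ≤ w.norm + lambdaLength R ε := by
  obtain ⟨hε, hv⟩ := witness_iff.1 h
  obtain ⟨l, h1, h2, h3⟩ := exists_lambdaLength_eq hε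
  obtain ⟨γ₁, ha₁, hl₁⟩ := exists_acts_diagonal R w
  obtain ⟨γ₂, ha₂, hl₂⟩ := exists_acts_of_product l h1 1
  rw [inv_one, one_mul, h2] at ha₂
  refine ⟨γ₁ * γ₂, by simpa using ha₁.mul ha₂, hv, (machineLength_mul_le _ _).trans ?_⟩
  rw [h3]
  exact add_le_add hl₁ hl₂

theorem ListConj.isConj (h : ListConj R σ u v) : IsConj (qElem R σ u) (qElem R σ v) := by
  obtain ⟨-, -, w, ε, hw⟩ := h
  obtain ⟨γ, ha, rfl, -⟩ := hw.exists_acts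
  rw [isConj_iff]
  -- The base element cancels the conjugating factor that the action of `γ` produces.
  refine ⟨baseM R (if σ 0 = 1 then w else w * ε) * γ, ?_⟩
  set c := baseM R (if σ 0 = 1 then w else w * ε) with hc
  calc c * γ * qElem R σ u * (c * γ)⁻¹ = c * (γ * qElem R σ u * γ⁻¹) * c⁻¹ := by group
    _ = _ := by
      rw [ha.conj_qElem σ u, ← hc]
      group

/-- Conjugators in the Miller machine project to witnesses of list conjugacy. -/
theorem listConjLength_le_conjLength (h : ListConj R σ u v) :
    listConjLength R σ u v ≤ conjLength R (qElem R σ u) (qElem R σ v) := by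
  obtain ⟨γ, hγ, hlen⟩ := exists_conjLength_eq h.isConj
  obtain ⟨hu, hv, w, ε, hw⟩ := h
  obtain ⟨s, hs, hrot⟩ := exists_rotation_twist hu hv hγ
  have hp := mk_rep_fst R γ
  have hnorm := norm_rep_fst_le γ
  generalize (rep R γ).right = p at hrot hp hnorm
  obtain ⟨a, b⟩ := p
  dsimp only at hrot hp hnorm
  have hv' : twist σ w⁻¹ (w * ε)⁻¹ v = u := by
    rw [(witness_iff.1 hw).2, twist_twist, inv_mul_cancel, inv_mul_cancel, twist_one]
  rw [← hv', twist_twist] at hrot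
  -- Writing `u` as a twist of `v` makes `hrot` a rotated twist of `v` equal to `v`; the twist alone
  -- then fixes `v`, so `(a, b)` carries `u` to `v` without rotation.
  have key := twist_eq_self hs hrot
  rw [← twist_twist, hv'] at key
  rw [hlen]
  refine le_trans (Nat.sInf_le ⟨a, a⁻¹ * b, witness_iff.2 ⟨?_, ?_⟩, rfl⟩) hnorm
  · rw [map_mul, map_inv, hp, inv_mul_cancel]
  · rw [mul_inv_cancel_left, key]

end length

/-! ### The upper bound -/

section upper

variable {k : ℕ} [NeZero k] {σ : Fin k → ℤˣ} {u v : Fin k → FreeGroup X}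

/-- If two cyclically consecutive exponents agree, then `ε` is determined by `w`. -/
theorem Witness.norm_le {w ε : FreeGroup X} (h : Witness R σ u v w ε) {i : Fin k}
    (hi : σ i = σ (i + 1)) : ε.norm ≤ 2 * w.norm + totalLength u v := by
  have hle : (u i).norm + (v i).norm ≤ totalLength u v :=
    Finset.single_le_sum (f := fun i => (u i).norm + (v i).norm) (fun _ _ => Nat.zero_le _)
      (Finset.mem_univ i)
  have hbound : ∀ a b c d : FreeGroup X, (a * b * c * d).norm ≤ a.norm + b.norm + c.norm + d.norm :=
    fun a b c d => by
      have e1 := FreeGroup.norm_mul_le (a * b * c) d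
      have e2 := FreeGroup.norm_mul_le (a * b) c
      have e3 := FreeGroup.norm_mul_le a b
      omega
  rcases Int.units_eq_one_or (σ i) with h1 | h1
  · have e := (h.2 i).1 h1 (hi ▸ h1)
    have : ε = w⁻¹ * v i * w * (u i)⁻¹ := by rw [← e]; group
    have e' := hbound w⁻¹ (v i) w (u i)⁻¹
    rw [← this, FreeGroup.norm_inv_eq, FreeGroup.norm_inv_eq] at e'
    omega
  · have e := (h.2 i).2.2.2 h1 (hi ▸ h1)
    have : ε = w⁻¹ * (v i)⁻¹ * w * u i := by rw [← e]; group
    have e' := hbound w⁻¹ (v i)⁻¹ w (u i)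
    rw [← this, FreeGroup.norm_inv_eq, FreeGroup.norm_inv_eq] at e'
    omega

theorem machineLength_take_le {k : ℕ} (σ : Fin k → ℤˣ) (u : Fin k → FreeGroup X) (s : ℕ) :
    machineLength R
        ((List.ofFn fun i => qM R ^ ((σ i : ℤˣ) : ℤ) * baseM R (u i)).take s).prod ≤
      k + ∑ i, (u i).norm := by
  refine (machineLength_prod_le _).trans ?_
  have hsub : ∀ L : List (Machine R), ((L.take s).map (machineLength R)).sum ≤
      (L.map (machineLength R)).sum := fun L =>
    ((List.take_sublist s L).map (machineLength R)).sum_le_sum fun _ _ => Nat.zero_le _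
  refine (hsub _).trans ?_
  rw [List.map_ofFn, List.sum_ofFn]
  have : k + ∑ i, (u i).norm = ∑ i, (1 + (u i).norm) := by simp [Finset.sum_add_distrib]
  rw [this]
  refine Finset.sum_le_sum fun i _ => (machineLength_mul_le _ _).trans ?_
  exact add_le_add (machineLength_qM_zpow_le _) (machineLength_baseM_le _)

/-- A rotation of `u` is list conjugate to `v` and has the same total length, so a shortest witness
for it is bounded by `C`; the conjugator is built from that witness. -/
theorem conjLength_le [Finite X] (hu : Reduced σ u) (hv : Reduced σ v)
    (h : IsConj (qElem R σ u) (qElem R σ v)) (hσ : ∃ i, σ i = σ (i + 1)) {n : ℕ}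
    (hn : totalLength u v + 2 * k ≤ n) :
    conjLength R (qElem R σ u) (qElem R σ v) ≤
      2 * (2 * CFun R σ n + n) + LambdaFun R (2 * CFun R σ n + n) := by
  obtain ⟨γ₀, hγ₀⟩ := isConj_iff.1 h
  obtain ⟨s, hs, hrot⟩ := exists_rotation_twist hu hv hγ₀
  have hp := mk_rep_fst R γ₀
  generalize (rep R γ₀).right = p at hrot hp
  obtain ⟨a, b⟩ := p
  dsimp only at hrot hp
  set u' : Fin k → FreeGroup X := fun i => u (i + s) with hu'
  have hlist : ListConj R σ u' v := by
    refine ⟨?_, hv, a, a⁻¹ * b, witness_iff.2 ⟨?_, ?_⟩⟩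
    · intro i hi
      rw [← hs i, ← hs (i + 1), add_right_comm] at hi
      exact hu (i + s) hi
    · rw [map_mul, map_inv, hp, inv_mul_cancel]
    · rw [mul_inv_cancel_left]
      funext i
      rw [← hrot i, twist_rotate hs]
  have hsum : ∑ i, (u' i).norm = ∑ i, (u i).norm :=
    Fintype.sum_equiv (Equiv.addRight s) _ _ fun _ => rfl
  have htot : totalLength u' v = totalLength u v := by
    rw [totalLength_eq, totalLength_eq, hsum]
  have htotu := totalLength_eq u v
  obtain ⟨w, ε, hw, hwlen⟩ := exists_listConjLength_eq hlist
  have hC : w.norm ≤ CFun R σ n := hwlen ▸ listConjLength_le_CFun hlist (by omega)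
  obtain ⟨i, hi⟩ := hσ
  have hε := hw.norm_le hi
  have hΛ : lambdaLength R ε ≤ LambdaFun R (2 * CFun R σ n + n) :=
    lambdaLength_le_LambdaFun (witness_iff.1 hw).1 (by omega)
  obtain ⟨γ, hγ, hvt, hγlen⟩ := hw.exists_acts
  have hγu := hγ.conj_qElem σ u'
  rw [← hvt] at hγu
  have hrotu := qWord_rotate (baseM R) (qM R) hs u
  rw [← qElem_eq_qWord, ← qElem_eq_qWord] at hrotu
  have hplen := machineLength_take_le (R := R) σ u s
  set P := ((List.ofFn fun i => qM R ^ ((σ i : ℤˣ) : ℤ) * baseM R (u i)).take s).prod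
  set c := if σ 0 = 1 then w else w * ε with hc
  have hclen : c.norm ≤ w.norm + ε.norm := by
    rw [hc]
    split_ifs
    · omega
    · exact FreeGroup.norm_mul_le _ _
  -- `P⁻¹` rotates `u` to `u'`, `γ` twists `u'` to `v`, and `c` cancels the leftover conjugating
  -- factor.
  have hconj : (baseM R c * γ * P⁻¹) * qElem R σ u * (baseM R c * γ * P⁻¹)⁻¹ = qElem R σ v := by
    calc _ = baseM R c * (γ * (P⁻¹ * qElem R σ u * P) * γ⁻¹) * (baseM R c)⁻¹ := by group
      _ = baseM R c * (γ * qElem R σ u' * γ⁻¹) * (baseM R c)⁻¹ := by rw [← hrotu]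
      _ = _ := by rw [hγu]; group
  refine (Nat.sInf_le ⟨_, hconj, rfl⟩ : conjLength R _ _ ≤ _).trans ?_
  have e1 := machineLength_mul_le (baseM R c * γ) P⁻¹
  have e2 := machineLength_mul_le (baseM R c) γ
  have e3 := machineLength_inv_le P
  have e4 := machineLength_baseM_le (R := R) c
  -- The factors cost at most `‖w‖ + ‖ε‖` for `c`, `‖w‖ + λ(ε)` for `γ` and `k + ∑ ‖uᵢ‖` for `P`,
  -- where `‖w‖ ≤ C` and `‖ε‖ ≤ 2C + totalLength u v`.
  omega

end upper

end Miller

theorem theoremC {X : Type*} [Fintype X] [DecidableEq X] (R : Finset (FreeGroup X)) :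
    (∀ (k : ℕ) [NeZero k] (σ : Fin k → ℤˣ), ∀ᶠ n : ℕ in Filter.atTop,
      (Miller.CFun R σ (n - 2 * k) : ℝ) / (Miller.tConst R : ℝ) ≤ (Miller.DFun R σ n : ℝ)) ∧
    ((∃ r ∈ R, r ≠ 1) →
      ∃ M N : ℕ, ∀ (k : ℕ) [NeZero k] (σ : Fin k → ℤˣ), (∃ i, σ i = σ (i + 1)) →
        ∀ n : ℕ, N ≤ n →
          Miller.DFun R σ n ≤
            (2 * M + 1) * Miller.LambdaFun R (2 * Miller.CFun R σ n + n)) := by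
  constructor
  · intro k _ σ
    -- For `n ≥ 2k` the truncated difference `n - 2k` is the true one.
    filter_upwards [Filter.eventually_ge_atTop (2 * k)] with n hn
    have ht : (1 : ℝ) ≤ (Miller.tConst R : ℝ) := by
      exact_mod_cast one_le_two.trans Miller.two_le_tConst
    -- The stronger bound without the divisor `t` is what is proved.
    refine (div_le_self (Nat.cast_nonneg _) ht).trans (Nat.cast_le.2 ?_)
    refine csSup_le' ?_
    rintro m ⟨u, v, h, hlen, rfl⟩
    exact (Miller.listConjLength_le_conjLength h).trans
      (Miller.conjLength_le_DFun h.1 h.2.1 h.isConj (by omega))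
  · intro hR
    -- With `m = 2C + n ≥ t`, linear growth gives `m ≤ M Λ(m)` for `M = 2t²`, so `2m + Λ(m) ≤ (2M +
    -- 1) Λ(m)`.
    refine ⟨2 * Miller.tConst R ^ 2, Miller.tConst R, fun k _ σ hσ n hn => ?_⟩
    refine csSup_le' ?_
    rintro m ⟨u, v, hu, hv, h, hlen, rfl⟩
    have e1 := Miller.conjLength_le hu hv h hσ hlen
    have e2 := Miller.le_mul_LambdaFun hR (hn.trans (Nat.le_add_left n (2 * Miller.CFun R σ n)))
    linarith
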